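/- **Setting.** Let $\mathcal G=(\mathcal I,\mathcal E)$ be a finite connected undirected (simple) graph with buses $\mathcal I=\{1,\dots,n\}$ and lines $\mathcal E=\{e_1,\dots,e_m\}$, arbitrarily oriented, with incidence matrix $D\in\mathbb R^{m\times n}$ ($d_{ki}=1$ if $i$ is the positive end of $e_k$, $-1$ if it is the negative end, $0$ otherwise). Let $M=\mathrm{diag}(M_i)$, $E=\mathrm{diag}(E_i)$, $Y_b=\mathrm{diag}(b_k)$ have positive diagonal entries (inertia, damping, susceptance). The linearized network dynamics with power injection $p(t)\in\mathbb R^n$ and control $\alpha(t)\in\mathbb R^n$ are $$\dot f=Y_bD\,\omega,\qquad M\dot\omega=-E\omega-D^{T}f+p+\alpha .$$ *Assumption on $p$:* each $p_i$ is piecewise continuous on $[0,\infty)$, there is $\bar t\in[0,\infty)$ with $p_i(t)=p_i^*$ for all $i$ and all $t\ge\bar t$, and $\sum_i p_i^*=0$. **Controller.** Let $\mathcal I^\omega\subseteq\mathcal I^u\subseteq\mathcal I$ be the targeted and the controlled buses. For $i\in\mathcal I^\omega$ let $\underline\omega_i<\underline\omega_i^{\rm thr}<0<\bar\omega_i^{\rm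 thr}<\bar\omega_i$ and $\underline\gamma_i,\bar\gamma_i>0$; for $i\in\mathcal I^u$ let $\epsilon_i,T_i,c_i>0$; let $d,T,\tilde t>0$ and $N=\lceil\tilde t/T\rceil$; let $0=\Delta^0<\Delta^1<\cdots\to\infty$ be sampling times, and let $p^{fcst}_t:[t,t+\tilde t]\to\mathbb R^n$ be arbitrary forecasts. The control is $\alpha=\alpha_{DF}+\alpha_{MPC}$, as follows. * *MPC.* For $t\in[\Delta^j,\Delta^{j+1})$, $u_{MPC}(t)=\hat u^*$ is the $\hat u$-component of an optimal solution of: minimize $\sum_{i\in\mathcal I^u}c_i\hat u_i^2+d\beta^2$ over $\hat f(k),\hat\omega(k),\hat\alpha(k)$ ($0\le k\le N$), $\hat u\in\mathbb R^n$, $\beta\in\mathbb R$ subject to, for $0\le k\le N-1$, $\hat f(k+1)=\hat f(k)+TY_bD\hat\omega(k)$; $M\hat\omega(k+1)=M\hat\omega(k)+T\{-E\hat\omega(k)-D^T\hat f(k)+p^{fcst}_{\Delta^j}(\Delta^j+kT)+\hat u\}$; $\hat\alpha_i(k+1)=\hat\alpha_i(k)+T\{-\hat\alpha_i(k)/T_i-\hat\omega_i(k)+\hat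 u_i\}$ for $i\in\mathcal I^u$; $\underline\omega_i-\beta\le\hat\omega_i(k+1)\le\bar\omega_i+\beta$ for $i\in\mathcal I^\omega$; and $\hat\alpha_i\equiv0$, $\hat u_i=0$ for $i\notin\mathcal I^u$; $(\hat f,\hat\omega,\hat\alpha)(0)=(f,\omega,\alpha_{MPC})(\Delta^j)$; $|\hat u_i|\le\epsilon_i|\alpha_{MPC,i}(\Delta^j)|$ for $i\in\mathcal I^u$. * *Stability filter and low-pass filter.* For $i\in\mathcal I^u$, $\hat u_{MPC,i}(t)$ is $u_{MPC,i}(t)$ saturated to $[-\epsilon_i|\alpha_{MPC,i}(t)|,\ \epsilon_i|\alpha_{MPC,i}(t)|]$ and $\dot\alpha_{MPC,i}=-\frac1{T_i}\alpha_{MPC,i}-\omega_i+\hat u_{MPC,i}$; for $i\notin\mathcal I^u$, $\alpha_{MPC,i}\equiv0$. * *Direct feedback.* With $v_i=E_i\omega_i+[D^Tf]_i-p_i-\alpha_{MPC,i}$, for $i\in\mathcal I^\omega$, $$\alpha_{DF,i}=\begin{cases}\min\{0,\ \frac{\bar\gamma_i(\bar\omega_i-\omega_i)}{\omega_i-\bar\omega_i^{\rm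 thr}}+v_i\}&\omega_i>\bar\omega_i^{\rm thr},\\ 0&\underline\omega_i^{\rm thr}\le\omega_i\le\bar\omega_i^{\rm thr},\\ \max\{0,\ \frac{\underline\gamma_i(\underline\omega_i-\omega_i)}{\underline\omega_i^{\rm thr}-\omega_i}+v_i\}&\omega_i<\underline\omega_i^{\rm thr},\end{cases}$$ and $\alpha_{DF,i}\equiv0$ for $i\notin\mathcal I^\omega$. A trajectory is a continuous solution on $[0,\infty)$ of the (open- or closed-loop) equations, the differential equations holding at all but at most countably many times (since $p$ and $u_{MPC}$ may jump). **Theorem.** Under the assumption on $p$, suppose $\epsilon_iT_i<1$ for every $i\in\mathcal I^u$. Then, for every trajectory $(f,\omega,\alpha_{MPC})$ of the closed-loop system and every initial state: 1. (Frequency invariance) for each $i\in\mathcal I^\omega$ with $\omega_i(0)\in[\underline\omega_i,\bar\omega_i]$, $\omega_i(t)\in[\underline\omega_i,\bar\omega_i]$ for all $t\ge0$; 2. (Frequency attractivity) for each $i\in\mathcal I^\omega$ with $\omega_i(0)\notin[\underline\omega_i,\bar\omega_i]$, there is a finite $t_0\ge 0$ with $\omega_i(t)\in[\underline\omega_i,\bar\omega_i]$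 for all $t\ge t_0$; 3. (Global convergence to the open-loop equilibrium) for every $f^0\in\mathbb R^m$ there is $f_\infty\in\mathbb R^m$ such that $(f_\infty,\mathbf 0_n)$ is the unique equilibrium $(f,\omega)$ with $f\in f^0+\mathrm{range}(Y_bD)$ of the open-loop system ($\alpha\equiv\mathbf 0_n$, injection $p^*$), and every trajectory, of the open-loop system as well as of the closed-loop system, with $f(0)\in f^0+\mathrm{range}(Y_bD)$ satisfies $(f(t),\omega(t))\to(f_\infty,\mathbf 0_n)$ as $t\to\infty$. (For physical flows, $f(0)=Y_bD\theta(0)$ with voltage angles $\theta(0)$, one takes $f^0=0$, so that $f_\infty$ depends only on $p^*$ and the network.) Furthermore, $\alpha(t)$, $\alpha_{MPC}(t)$ and $\alpha_{DF}(t)$ converge to $\mathbf 0_n$ as $t\to\infty$. -/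

import Mathlib

open Set Filter Topology Matrix

noncomputable section

/-- Piecewise continuity on `[0,∞)`: finitely many discontinuities on every bounded interval, with
finite one-sided limits at each of them. -/
def PiecewiseContinuous (g : ℝ → ℝ) : Prop :=
  ∃ S : Set ℝ, (∀ R : ℝ, (S ∩ Icc 0 R).Finite) ∧
    (∀ t, 0 ≤ t → t ∉ S → ContinuousWithinAt g (Ici 0) t) ∧
    ∀ t ∈ S, 0 ≤ t → (∃ l, Tendsto g (𝓝[>] t) (𝓝 l)) ∧ (0 < t → ∃ l, Tendsto g (𝓝[<] t) (𝓝 l))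

/-- The saturation function with upper limit `amax` and lower limit `amin`. -/
def sat (a amax amin : ℝ) : ℝ :=
  if amax ≤ a then amax else if a ≤ amin then amin else a

/-- A power network on the buses `V`: a connected undirected graph whose edges are enumerated by
`L` and oriented arbitrarily, with inertia and damping coefficients at the buses and a
susceptance on each line. -/
structure PowerNetwork (V L : Type*) where
  graph : SimpleGraph V
  connected : graph.Connected
  edge : L ≃ graph.edgeSet
  posEnd : L → V
  negEnd : L → V
  ends : ∀ k, s(posEnd k, negEnd k) = (edge k : Sym2 V)
  inertia : V → ℝ
  inertia_pos : ∀ i, 0 < inertia i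
  damping : V → ℝ
  damping_pos : ∀ i, 0 < damping i
  susceptance : L → ℝ
  susceptance_pos : ∀ k, 0 < susceptance k

namespace PowerNetwork

variable {V L : Type*} [Fintype V] [DecidableEq V] [Fintype L] [DecidableEq L]
  (N : PowerNetwork V L)

/-- The matrix `M`. -/
def M : Matrix V V ℝ := Matrix.diagonal N.inertia

/-- The matrix `E`. -/
def E : Matrix V V ℝ := Matrix.diagonal N.damping

/-- The matrix `Y_b`. -/
def Y : Matrix L L ℝ := Matrix.diagonal N.susceptance

/-- The incidence matrix `D`. -/
def D : Matrix L V ℝ := fun k i =>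
  if i = N.posEnd k then 1 else if i = N.negEnd k then -1 else 0

/-- The net force `-Eω - Dᵀf + p + α` in the swing equation `M ω̇ = -Eω - Dᵀf + p + α`. -/
def swing (f : L → ℝ) (ω p α : V → ℝ) : V → ℝ :=
  -(N.E *ᵥ ω) - N.Dᵀ *ᵥ f + p + α

/-- At the time `t` the linearized network dynamics hold with injection `p` and control `α`. -/
def DynamicsAt (f : ℝ → L → ℝ) (ω : ℝ → V → ℝ) (p α : V → ℝ) (t : ℝ) : Prop :=
  HasDerivAt f (N.Y *ᵥ (N.D *ᵥ ω t)) t ∧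
    ∃ ω' : V → ℝ, HasDerivAt ω ω' t ∧ N.M *ᵥ ω' = N.swing (f t) (ω t) p α

/-- Two flow vectors that differ by an element of the range of `Y_b D`. The class of the zero flow
consists of the flows `Y_b D θ` that are induced by voltage angles `θ`. -/
def SameClass (f g : L → ℝ) : Prop :=
  ∃ θ : V → ℝ, f - g = N.Y *ᵥ (N.D *ᵥ θ)

/-- `(f, ω)` is an equilibrium of the open-loop system with the constant injection `p`. -/
def IsOpenLoopEquilibrium (p : V → ℝ) (f : L → ℝ) (ω : V → ℝ) : Prop :=
  N.Y *ᵥ (N.D *ᵥ ω) = 0 ∧ N.swing f ω p 0 = 0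

/-- Trajectories on `[0,∞)` of the open-loop system (`α ≡ 0`): continuous, satisfying the
differential equation at all but countably many times (the injection may jump). -/
structure IsOpenLoopTrajectory (p : ℝ → V → ℝ) (f : ℝ → L → ℝ) (ω : ℝ → V → ℝ) : Prop where
  continuousOn_f : ContinuousOn f (Ici 0)
  continuousOn_ω : ContinuousOn ω (Ici 0)
  ode : ∃ S : Set ℝ, S.Countable ∧ ∀ t, 0 < t → t ∉ S → N.DynamicsAt f ω (p t) 0 t

end PowerNetwork

/-- Each injection is piecewise continuous, and after some finite time the injections are constant,
equal to `pstar`, and balanced. -/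
structure FiniteTimeConvergent {V : Type*} [Fintype V] (p : ℝ → V → ℝ) (pstar : V → ℝ) : Prop where
  piecewise : ∀ i, PiecewiseContinuous fun t => p t i
  eventually_const : ∃ tbar : ℝ, 0 ≤ tbar ∧ ∀ i, ∀ t, tbar ≤ t → p t i = pstar i
  balanced : ∑ i, pstar i = 0

/-- The design data of the controller. -/
structure ControllerData (V : Type*) where
  /-- The controlled buses. -/
  Iu : Finset V
  /-- The buses with a transient frequency requirement. -/
  Iω : Finset V
  Iω_subset : Iω ⊆ Iu
  /-- The safe frequency bounds and the thresholds of the top layer. -/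
  lo : V → ℝ
  loThr : V → ℝ
  hiThr : V → ℝ
  hi : V → ℝ
  lo_lt : ∀ i ∈ Iω, lo i < loThr i
  loThr_neg : ∀ i ∈ Iω, loThr i < 0
  hiThr_pos : ∀ i ∈ Iω, 0 < hiThr i
  lt_hi : ∀ i ∈ Iω, hiThr i < hi i
  /-- The gains of the top layer. -/
  γlo : V → ℝ
  γhi : V → ℝ
  γlo_pos : ∀ i ∈ Iω, 0 < γlo i
  γhi_pos : ∀ i ∈ Iω, 0 < γhi i
  /-- The sensitivity coefficients. -/
  ε : V → ℝ
  ε_pos : ∀ i ∈ Iu, 0 < ε i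
  /-- The time constants `T_i` of the low-pass filter. -/
  τ : V → ℝ
  τ_pos : ∀ i ∈ Iu, 0 < τ i
  /-- The weights of the cost function. -/
  c : V → ℝ
  c_pos : ∀ i ∈ Iu, 0 < c i
  d : ℝ
  d_pos : 0 < d
  /-- The step `T` of the discretization and the length of the forecast window. -/
  T : ℝ
  T_pos : 0 < T
  window : ℝ
  window_pos : 0 < window
  /-- The sampling points. -/
  Δ : ℕ → ℝ
  Δ_zero : Δ 0 = 0
  Δ_strictMono : StrictMono Δ
  Δ_tendsto : Tendsto Δ atTop atTop

/-- The number of prediction steps. -/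
def ControllerData.horizon {V : Type*} (C : ControllerData V) : ℕ := ⌈C.window / C.T⌉₊

/-- The decision variables `(F̂, Ω̂, Â, û, β)` of the MPC problem with `n` prediction steps. -/
structure MPCVars (V L : Type*) (n : ℕ) where
  f : Fin (n + 1) → L → ℝ
  ω : Fin (n + 1) → V → ℝ
  a : Fin (n + 1) → V → ℝ
  u : V → ℝ
  β : ℝ

section Controller

variable {V L : Type*} [Fintype V] [DecidableEq V] [Fintype L] [DecidableEq L]
  (N : PowerNetwork V L) (C : ControllerData V)

/-- The constraints of the MPC problem with sampled state `(f₀, ω₀, a₀)` and forecast `phat`. -/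
structure MPCFeasible (phat : Fin C.horizon → V → ℝ) (f₀ : L → ℝ) (ω₀ a₀ : V → ℝ)
    (x : MPCVars V L C.horizon) : Prop where
  flow : ∀ k : Fin C.horizon,
    x.f k.succ = x.f k.castSucc + C.T • (N.Y *ᵥ (N.D *ᵥ x.ω k.castSucc))
  freq : ∀ k : Fin C.horizon,
    N.M *ᵥ x.ω k.succ = N.M *ᵥ x.ω k.castSucc
      + C.T • N.swing (x.f k.castSucc) (x.ω k.castSucc) (phat k) x.u
  filter : ∀ k : Fin C.horizon, ∀ i ∈ C.Iu,
    x.a k.succ i = x.a k.castSucc i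
      + C.T * (-(x.a k.castSucc i / C.τ i) - x.ω k.castSucc i + x.u i)
  filter_zero : ∀ k, ∀ i ∉ C.Iu, x.a k i = 0
  control : ∀ i ∉ C.Iu, x.u i = 0
  init_f : x.f 0 = f₀
  init_ω : x.ω 0 = ω₀
  init_a : x.a 0 = a₀
  bounds : ∀ k : Fin C.horizon, ∀ i ∈ C.Iω,
    C.lo i - x.β ≤ x.ω k.succ i ∧ x.ω k.succ i ≤ C.hi i + x.β
  sensitivity : ∀ i ∈ C.Iu, |x.u i| ≤ C.ε i * |a₀ i|

/-- The cost function of the MPC problem. -/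
def mpcCost {n : ℕ} (x : MPCVars V L n) : ℝ :=
  ∑ i ∈ C.Iu, C.c i * x.u i ^ 2 + C.d * x.β ^ 2

/-- `x` is an optimal solution of the MPC problem. -/
def MPCOptimal (phat : Fin C.horizon → V → ℝ) (f₀ : L → ℝ) (ω₀ a₀ : V → ℝ)
    (x : MPCVars V L C.horizon) : Prop :=
  MPCFeasible N C phat f₀ ω₀ a₀ x ∧
    ∀ y, MPCFeasible N C phat f₀ ω₀ a₀ y → mpcCost C x ≤ mpcCost C y

/-- The stability filter. -/
def stabilityFilter (a u : V → ℝ) (i : V) : ℝ :=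
  sat (u i) (C.ε i * |a i|) (-(C.ε i * |a i|))

/-- The quantity `v_i = E_i ω_i + [Dᵀ]_i f - p_i - α_{MPC,i}` of the top layer. -/
def topLayerV (f : L → ℝ) (ω p a : V → ℝ) (i : V) : ℝ :=
  N.damping i * ω i + (N.Dᵀ *ᵥ f) i - p i - a i

/-- The direct-feedback control `α_DF` of the top layer. -/
def alphaDF (f : L → ℝ) (ω p a : V → ℝ) (i : V) : ℝ :=
  if i ∈ C.Iω then
    if C.hiThr i < ω i then
      min 0 (C.γhi i * (C.hi i - ω i) / (ω i - C.hiThr i) + topLayerV N f ω p a i)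
    else if ω i < C.loThr i then
      max 0 (C.γlo i * (C.lo i - ω i) / (C.loThr i - ω i) + topLayerV N f ω p a i)
    else 0
  else 0

/-- The overall control `α = α_DF + α_MPC`. -/
def alphaTotal (f : L → ℝ) (ω p a : V → ℝ) : V → ℝ :=
  alphaDF N C f ω p a + a

/-- Trajectories on `[0,∞)` of the closed-loop system with injection `p` and forecasts `pf`, where
`pf t` is the forecast that is made at the time `t`: `a` is the state `α_MPC` of the low-pass
filter and `u` is the output `u_MPC` of the MPC component. The differential equations hold at
all but countably many times, as `p` and `u` may jump. -/
structure IsClosedLoopTrajectory (p : ℝ → V → ℝ) (pf : ℝ → ℝ → V → ℝ)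
    (f : ℝ → L → ℝ) (ω a u : ℝ → V → ℝ) : Prop where
  continuousOn_f : ContinuousOn f (Ici 0)
  continuousOn_ω : ContinuousOn ω (Ici 0)
  continuousOn_a : ContinuousOn a (Ici 0)
  mpc : ∀ j : ℕ, ∃ x : MPCVars V L C.horizon,
    MPCOptimal N C (fun k => pf (C.Δ j) (C.Δ j + (k : ℕ) * C.T))
      (f (C.Δ j)) (ω (C.Δ j)) (a (C.Δ j)) x ∧
    ∀ t ∈ Ico (C.Δ j) (C.Δ (j + 1)), u t = x.u
  filter_zero : ∀ t, 0 ≤ t → ∀ i ∉ C.Iu, a t i = 0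
  ode : ∃ S : Set ℝ, S.Countable ∧ ∀ t, 0 < t → t ∉ S →
    N.DynamicsAt f ω (p t) (alphaTotal N C (f t) (ω t) (p t) (a t)) t ∧
    ∀ i ∈ C.Iu, HasDerivAt (fun s => a s i)
      (-(1 / C.τ i) * a t i - ω t i + stabilityFilter C (a t) (u t) i) t

end Controller

end

/-!
Frequency invariance is a barrier argument at a single bus. Above the upper bound the top layer
cancels the net force and adds a nonpositive term, so the frequency cannot increase there
(`alphaDF_le_topLayerV`); the lower bound is symmetric, and `le_of_barrier` concludes.

Convergence is a Lyapunov argument. Only the following features of the controller enter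
(`DissipativeTrajectory`). The stability filter keeps the input of the low-pass filter below
`ε |a|`, whatever the optimization returns, and `ε τ < 1` then makes the filter a strictly passive
system driven by `-ω`. The direct feedback `α_DF` never has the sign of the frequency, is bounded
in terms of the net force, and vanishes near zero frequency. Hence, once the injection is
constant, the sum of the kinetic energy, the flow energy relative to the equilibrium flow, and the
filter energy decreases at least at the rate `∑ Eᵢ ωᵢ² + κᵢ aᵢ²` (`hasDerivAt_energy`). All signals
are therefore bounded and Lipschitz, and Barbalat's lemma (`tendsto_zero_of_dissipation`) gives
`ω → 0` and `a → 0`. From then on `α_DF = 0`. As `ω` and its increments over unit time intervals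
tend to zero, the swing equation forces `Dᵀ (f - f∞) → 0` (`tendsto_line_force`), and since
`f - f∞` stays in the range of `Y_b D`, on which `Dᵀ` is injective, `f → f∞`. The open-loop
system is the case in which filter and feedback are both zero.

The equilibrium flow exists because the range of the Laplacian `Dᵀ Y_b D` of a connected graph
contains every balanced vector (`exists_laplacian_eq`).

As the differential equations may fail at countably many times, all estimates rest on a mean value
inequality with a countable exceptional set (`sub_le_mul_of_hasDerivAt_le_off_countable`).
-/

set_option linter.unusedSectionVars false

/-! ### Calculus with a countable exceptional set -/

/-- A level strictly between `F a` and `F b` that `F` does not attain on the countable set `S` is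
crossed for the last time at a point outside `S`, where the derivative cannot be negative. -/
theorem le_of_hasDerivAt_neg_off_countable {F : ℝ → ℝ} {a b : ℝ} (hab : a ≤ b)
    (hF : ContinuousOn F (Icc a b)) {S : Set ℝ} (hS : S.Countable)
    (h : ∀ t ∈ Ioo a b, t ∉ S → ∃ y < 0, HasDerivAt F y t) : F b ≤ F a := by
  by_contra! hlt
  obtain ⟨c, hcS, hc⟩ : ∃ c ∈ (F '' S)ᶜ, c ∈ Ioo (F a) (F b) := by
    have := ((hS.image F).dense_compl ℝ).inter_open_nonempty _ isOpen_Ioo (nonempty_Ioo.2 hlt)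
    obtain ⟨c, h1, h2⟩ := this
    exact ⟨c, h2, h1⟩
  have hcomp : IsCompact (Icc a b ∩ F ⁻¹' {c}) :=
    isCompact_Icc.of_isClosed_subset
      (hF.preimage_isClosed_of_isClosed isClosed_Icc isClosed_singleton)
      inter_subset_left
  have hne : (Icc a b ∩ F ⁻¹' {c}).Nonempty := by
    obtain ⟨x, hx, hxc⟩ := intermediate_value_Icc hab hF ⟨hc.1.le, hc.2.le⟩
    exact ⟨x, hx, hxc⟩
  obtain ⟨x, ⟨hx, hxc⟩, hmax⟩ := hcomp.exists_isGreatest hne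
  have hxc : F x = c := hxc
  have hxa : a < x := lt_of_le_of_ne hx.1 (by rintro rfl; exact hc.1.ne hxc)
  have hxb : x < b := lt_of_le_of_ne hx.2 (by rintro rfl; exact hc.2.ne' hxc)
  obtain ⟨y, hy, hder⟩ := h x ⟨hxa, hxb⟩ fun hxS => hcS ⟨x, hxS, hxc⟩
  have habove : ∀ t ∈ Ioc x b, c ≤ F t := by
    intro t ht
    by_contra! htc
    obtain ⟨z, hz, hzc⟩ := intermediate_value_Icc ht.2
      (hF.mono (Icc_subset_Icc_left (hxa.trans ht.1).le)) ⟨htc.le, hc.2.le⟩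
    have := hmax ⟨⟨(hxa.trans ht.1).le.trans hz.1, hz.2⟩, hzc⟩
    exact absurd (ht.1.trans_le hz.1) this.not_gt
  have hslope := (hasDerivWithinAt_iff_tendsto_slope' (s := Ioi x) self_notMem_Ioi).1
    hder.hasDerivWithinAt
  have : 0 ≤ y := by
    refine ge_of_tendsto hslope ?_
    filter_upwards [Ioc_mem_nhdsGT hxb] with t ht
    rw [slope_def_field, hxc]
    exact div_nonneg (sub_nonneg.2 (habove t ht)) (sub_nonneg.2 ht.1.le)
  exact absurd hy this.not_gt

theorem sub_le_mul_of_hasDerivAt_le_off_countable {F : ℝ → ℝ} {a b C : ℝ} (hab : a ≤ b)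
    (hF : ContinuousOn F (Icc a b)) {S : Set ℝ} (hS : S.Countable)
    (h : ∀ t ∈ Ioo a b, t ∉ S → ∃ y ≤ C, HasDerivAt F y t) : F b - F a ≤ C * (b - a) := by
  have key : ∀ η > 0, F b - F a ≤ C * (b - a) + η * (b - a) := by
    intro η hη
    have := le_of_hasDerivAt_neg_off_countable (F := fun t => F t - (C + η) * t) hab
      (hF.sub (by fun_prop)) hS (by
        intro t ht htS
        obtain ⟨y, hy, hd⟩ := h t ht htS
        exact ⟨y - (C + η) * 1, by linarith, hd.sub ((hasDerivAt_id t).const_mul (C + η))⟩)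
    linarith
  have hlim : Tendsto (fun η : ℝ => C * (b - a) + η * (b - a)) (𝓝[>] 0) (𝓝 (C * (b - a))) := by
    have : Tendsto (fun η : ℝ => C * (b - a) + η * (b - a)) (𝓝 0)
        (𝓝 (C * (b - a) + 0 * (b - a))) := (Continuous.tendsto (by fun_prop) 0)
    simpa using this.mono_left nhdsWithin_le_nhds
  exact ge_of_tendsto hlim (by filter_upwards [self_mem_nhdsWithin] with η hη using key η hη)

theorem abs_sub_le_mul_of_hasDerivAt_off_countable {F : ℝ → ℝ} {a b C : ℝ} (hab : a ≤ b)
    (hF : ContinuousOn F (Icc a b)) {S : Set ℝ} (hS : S.Countable)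
    (h : ∀ t ∈ Ioo a b, t ∉ S → ∃ y, |y| ≤ C ∧ HasDerivAt F y t) :
    |F b - F a| ≤ C * (b - a) := by
  have h1 := sub_le_mul_of_hasDerivAt_le_off_countable (C := C) hab hF hS fun t ht htS => by
    obtain ⟨y, hy, hd⟩ := h t ht htS
    exact ⟨y, (abs_le.1 hy).2, hd⟩
  have h2 := sub_le_mul_of_hasDerivAt_le_off_countable (F := fun t => -F t) (C := C) hab hF.neg hS
    fun t ht htS => by
      obtain ⟨y, hy, hd⟩ := h t ht htS
      exact ⟨-y, by linarith [(abs_le.1 hy).1], hd.neg⟩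
  rw [abs_le]
  constructor <;> linarith

/-- A form of Barbalat's lemma: a Lipschitz signal whose square is dissipated by a nonnegative
storage function tends to zero. -/
theorem tendsto_zero_of_dissipation {W x : ℝ → ℝ} {t₁ K κ : ℝ} {S : Set ℝ} (hS : S.Countable)
    (hκ : 0 < κ) (hW : ContinuousOn W (Ici t₁)) (hW0 : ∀ t, 0 ≤ W t)
    (hx : ContinuousOn x (Ici t₁))
    (hW' : ∀ t, t₁ < t → t ∉ S → ∃ y ≤ -(κ * x t ^ 2), HasDerivAt W y t)
    (hx' : ∀ t, t₁ < t → t ∉ S → ∃ y, |y| ≤ K ∧ HasDerivAt x y t) :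
    Tendsto x atTop (𝓝 0) := by
  have sub : ∀ s t, t₁ ≤ s → Icc s t ⊆ Ici t₁ := fun s t hs u hu => hs.trans hu.1
  have hanti : ∀ s t, t₁ ≤ s → s ≤ t → W t ≤ W s := by
    intro s t hs hst
    have := sub_le_mul_of_hasDerivAt_le_off_countable (C := 0) hst (hW.mono (sub s t hs)) hS
      fun u hu huS => by
        obtain ⟨y, hy, hd⟩ := hW' u (hs.trans_lt hu.1) huS
        exact ⟨y, hy.trans (neg_nonpos.2 (by positivity)), hd⟩
    linarith
  have hlim : ∃ l, Tendsto W atTop (𝓝 l) := by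
    have hA : Antitone fun t => W (max t₁ t) := fun s t hst =>
      hanti _ _ (le_max_left _ _) (max_le_max le_rfl hst)
    have := tendsto_atTop_ciInf hA ⟨0, by rintro _ ⟨t, rfl⟩; exact hW0 _⟩
    refine ⟨_, this.congr' ?_⟩
    filter_upwards [eventually_ge_atTop t₁] with t ht
    rw [max_eq_right ht]
  obtain ⟨l, hl⟩ := hlim
  rw [Metric.tendsto_atTop']
  intro η hη
  -- On an interval of length `h` the signal cannot drop from `η` below `η / 2`.
  set h : ℝ := η / (2 * (|K| + 1)) with hh
  have hhpos : 0 < h := by positivity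
  have hKh : |K| * h ≤ η / 2 := by
    rw [hh, mul_div_assoc', div_le_div_iff₀ (by positivity) two_pos]
    nlinarith [abs_nonneg K]
  have hdiff : Tendsto (fun t => W t - W (t + h)) atTop (𝓝 0) := by
    simpa using hl.sub (hl.comp (tendsto_atTop_add_const_right _ h tendsto_id))
  have hev := hdiff.eventually_lt_const (show 0 < κ * (η / 2) ^ 2 * h by positivity)
  obtain ⟨t₂, ht₂⟩ := eventually_atTop.1 hev
  refine ⟨max t₁ t₂, fun t ht => ?_⟩
  rw [Real.dist_eq, sub_zero]
  by_contra! hηx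
  have ht1 : t₁ < t := (le_max_left _ _).trans_lt ht
  have hlow : ∀ s ∈ Icc t (t + h), η / 2 ≤ |x s| := by
    intro s hs
    have := abs_sub_le_mul_of_hasDerivAt_off_countable (C := |K|) hs.1
      (hx.mono (sub t s ht1.le)) hS fun u hu huS => by
        obtain ⟨y, hy, hd⟩ := hx' u (ht1.trans hu.1) huS
        exact ⟨y, hy.trans (le_abs_self K), hd⟩
    have h2 : |K| * (s - t) ≤ |K| * h :=
      mul_le_mul_of_nonneg_left (by linarith [hs.2]) (abs_nonneg K)
    have h3 := abs_sub_abs_le_abs_sub (x t) (x s)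
    rw [abs_sub_comm] at h3
    linarith
  have hdrop := sub_le_mul_of_hasDerivAt_le_off_countable (C := -(κ * (η / 2) ^ 2))
    (show t ≤ t + h by linarith) (hW.mono (sub t (t + h) ht1.le)) hS fun u hu huS => by
      obtain ⟨y, hy, hd⟩ := hW' u (ht1.trans hu.1) huS
      refine ⟨y, hy.trans (neg_le_neg (mul_le_mul_of_nonneg_left ?_ hκ.le)), hd⟩
      rw [← sq_abs (x u)]
      exact pow_le_pow_left₀ (by positivity) (hlow u ⟨hu.1.le, hu.2.le⟩) 2
  have := ht₂ t ((le_max_right _ _).trans ht.le)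
  simp only [add_sub_cancel_left] at hdrop
  linarith

/-- A continuous function that is nonincreasing (off a countable set) whenever it exceeds `c` never
crosses `c` upwards. -/
theorem le_of_barrier {x : ℝ → ℝ} {c t : ℝ} (ht : 0 ≤ t) (hx : ContinuousOn x (Ici 0))
    {S : Set ℝ} (hS : S.Countable) (h0 : x 0 ≤ c)
    (h : ∀ s, 0 < s → s ∉ S → c < x s → ∃ y ≤ 0, HasDerivAt x y s) : x t ≤ c := by
  by_contra! hlt
  have hxt : ContinuousOn x (Icc 0 t) := hx.mono Icc_subset_Ici_self
  have hcomp : IsCompact (Icc 0 t ∩ x ⁻¹' Iic c) :=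
    isCompact_Icc.of_isClosed_subset (hxt.preimage_isClosed_of_isClosed isClosed_Icc isClosed_Iic)
      inter_subset_left
  obtain ⟨s, ⟨hs, hsc⟩, hmax⟩ := hcomp.exists_isGreatest ⟨0, ⟨le_rfl, ht⟩, h0⟩
  have hsc : x s ≤ c := hsc
  have := sub_le_mul_of_hasDerivAt_le_off_countable (C := 0) hs.2
    (hxt.mono (Icc_subset_Icc_left hs.1)) hS fun u hu huS =>
      h u (hs.1.trans_lt hu.1) huS <| by
        by_contra! huc
        exact absurd (hmax ⟨⟨hs.1.trans hu.1.le, hu.2.le⟩, huc⟩) hu.1.not_ge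
  linarith

/-! ### The incidence matrix and the equilibria -/

namespace PowerNetwork

variable {V L : Type*} [Fintype V] [DecidableEq V] [Fintype L] [DecidableEq L]
  (N : PowerNetwork V L)

theorem posEnd_ne_negEnd (k : L) : N.posEnd k ≠ N.negEnd k := by
  have h := (N.edge k).2
  rw [← N.ends k, SimpleGraph.mem_edgeSet] at h
  exact h.ne

theorem D_mulVec (θ : V → ℝ) (k : L) :
    (N.D *ᵥ θ) k = θ (N.posEnd k) - θ (N.negEnd k) := by
  have h : ∀ i, N.D k i * θ i = (if i = N.posEnd k then θ i else 0)
      - (if i = N.negEnd k then θ i else 0) := by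
    intro i
    have := N.posEnd_ne_negEnd k
    unfold D
    split_ifs with h1 h2 <;> simp_all
  simp [Matrix.mulVec, dotProduct, h, Finset.sum_sub_distrib]

theorem eq_of_D_mulVec_eq_zero {θ : V → ℝ} (h : N.D *ᵥ θ = 0) (i j : V) : θ i = θ j := by
  have hadj : ∀ i j, N.graph.Adj i j → θ i = θ j := by
    intro i j hij
    obtain ⟨k, hk⟩ := N.edge.surjective ⟨s(i, j), hij⟩
    have hends := N.ends k
    rw [hk] at hends
    have hk0 := congrFun h k
    rw [D_mulVec, Pi.zero_apply, sub_eq_zero] at hk0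
    rcases Sym2.eq_iff.1 hends with ⟨h1, h2⟩ | ⟨h1, h2⟩
    · rw [← h1, ← h2, hk0]
    · rw [← h1, ← h2, hk0]
  obtain ⟨w⟩ := N.connected.preconnected i j
  induction w with
  | nil => rfl
  | cons h _ ih => exact (hadj _ _ h).trans ih

theorem sum_transpose_D_mulVec (f : L → ℝ) : ∑ i, (N.Dᵀ *ᵥ f) i = 0 := by
  have h : (fun _ => (1 : ℝ)) ⬝ᵥ (N.Dᵀ *ᵥ f) = 0 := by
    rw [dotProduct_mulVec, vecMul_transpose]
    have : N.D *ᵥ (fun _ => (1 : ℝ)) = 0 := by ext k; simp [D_mulVec]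
    rw [this, zero_dotProduct]
  simpa [dotProduct] using h

/-- The energy identity `⟨θ, Dᵀ Y_b D θ⟩ = ∑ₖ bₖ (Dθ)ₖ²` shows that `Dᵀ` is injective on the range
of `Y_b D`. -/
theorem D_mulVec_eq_zero_of_dotProduct {θ : V → ℝ}
    (h : θ ⬝ᵥ (N.Dᵀ *ᵥ (N.Y *ᵥ (N.D *ᵥ θ))) = 0) : N.D *ᵥ θ = 0 := by
  rw [dotProduct_mulVec, vecMul_transpose] at h
  simp only [dotProduct, Y, mulVec_diagonal] at h
  have hnn : ∀ k ∈ Finset.univ, 0 ≤ (N.D *ᵥ θ) k * (N.susceptance k * (N.D *ᵥ θ) k) := by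
    intro k _
    have := N.susceptance_pos k
    nlinarith [mul_nonneg this.le (mul_self_nonneg ((N.D *ᵥ θ) k))]
  ext k
  have hk := (Finset.sum_eq_zero_iff_of_nonneg hnn).1 h k (Finset.mem_univ k)
  have hb := (N.susceptance_pos k).ne'
  simpa [hb] using hk

/-- The range of the map `Y_b D`, the space of flows that are induced by voltage angles. -/
noncomputable def flowSpace : Submodule ℝ (L → ℝ) :=
  LinearMap.range (N.Y.mulVecLin ∘ₗ N.D.mulVecLin)

theorem mem_flowSpace {g : L → ℝ} :
    g ∈ N.flowSpace ↔ ∃ θ : V → ℝ, N.Y *ᵥ (N.D *ᵥ θ) = g := by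
  simp [flowSpace, LinearMap.mem_range]

theorem sameClass_iff {f g : L → ℝ} : N.SameClass f g ↔ f - g ∈ N.flowSpace := by
  simp only [SameClass, mem_flowSpace, eq_comm]

theorem eq_zero_of_mem_flowSpace {g : L → ℝ} (hg : g ∈ N.flowSpace) (h : N.Dᵀ *ᵥ g = 0) :
    g = 0 := by
  obtain ⟨θ, rfl⟩ := N.mem_flowSpace.1 hg
  rw [N.D_mulVec_eq_zero_of_dotProduct (by rw [h, dotProduct_zero]), mulVec_zero]

theorem exists_norm_le_of_mem_flowSpace :
    ∃ K : ℝ, ∀ g ∈ N.flowSpace, ‖g‖ ≤ K * ‖N.Dᵀ *ᵥ g‖ := by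
  have hinj : LinearMap.ker (N.Dᵀ.mulVecLin ∘ₗ N.flowSpace.subtype) = ⊥ := by
    rw [LinearMap.ker_eq_bot']
    rintro ⟨g, hg⟩ h
    exact Subtype.ext (N.eq_zero_of_mem_flowSpace hg (by simpa [mulVec_transpose] using h))
  obtain ⟨K, -, hK⟩ := LinearMap.exists_antilipschitzWith _ hinj
  refine ⟨K, fun g hg => ?_⟩
  have := hK.le_mul_dist ⟨g, hg⟩ 0
  simpa [dist_eq_norm, mulVec_transpose] using this

/-- The weighted Laplacian `Dᵀ Y_b D` is symmetric and its kernel consists of the constant vectors,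
so its range contains every balanced vector. -/
theorem exists_laplacian_eq {b : V → ℝ} (hb : ∑ i, b i = 0) :
    ∃ θ : V → ℝ, N.Dᵀ *ᵥ (N.Y *ᵥ (N.D *ᵥ θ)) = b := by
  by_contra! hne
  let A : (V → ℝ) →ₗ[ℝ] (V → ℝ) := N.Dᵀ.mulVecLin ∘ₗ N.Y.mulVecLin ∘ₗ N.D.mulVecLin
  have hb' : b ∉ LinearMap.range A := by
    rintro ⟨θ, hθ⟩
    exact hne θ hθ
  obtain ⟨φ, hφb, hφ⟩ := Submodule.exists_le_ker_of_notMem hb'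
  have hrep : ∀ y, φ y = (fun i => φ (Pi.single i 1)) ⬝ᵥ y := by
    intro y
    rw [LinearMap.pi_apply_eq_sum_univ φ y, dotProduct]
    refine Finset.sum_congr rfl fun i _ => ?_
    rw [smul_eq_mul, mul_comm]
    congr 2
    ext j
    simp [Pi.single_apply, eq_comm]
  set x : V → ℝ := fun i => φ (Pi.single i 1)
  have hx : N.D *ᵥ x = 0 := by
    refine N.D_mulVec_eq_zero_of_dotProduct ?_
    rw [← hrep]
    exact hφ ⟨x, rfl⟩
  obtain ⟨i₀⟩ := N.connected.nonempty
  apply hφb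
  rw [hrep, dotProduct]
  simp_rw [N.eq_of_D_mulVec_eq_zero hx _ i₀]
  rw [← Finset.mul_sum, hb, mul_zero]

theorem isOpenLoopEquilibrium_iff {p : V → ℝ} (hp : ∑ i, p i = 0) {g : L → ℝ} {η : V → ℝ} :
    N.IsOpenLoopEquilibrium p g η ↔ N.Dᵀ *ᵥ g = p ∧ η = 0 := by
  constructor
  · rintro ⟨h1, h2⟩
    have hD : N.D *ᵥ η = 0 := by
      apply N.D_mulVec_eq_zero_of_dotProduct
      rw [h1, mulVec_zero, dotProduct_zero]
    obtain ⟨i₀⟩ := N.connected.nonempty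
    have hconst := fun i => N.eq_of_D_mulVec_eq_zero hD i i₀
    have hswing : ∀ i, -(N.damping i * η i₀) - (N.Dᵀ *ᵥ g) i + p i = 0 := by
      intro i
      have := congrFun h2 i
      simpa [swing, E, mulVec_diagonal, hconst i] using this
    have hsum : ∑ i, (-(N.damping i * η i₀) - (N.Dᵀ *ᵥ g) i + p i) = 0 := by simp [hswing]
    rw [Finset.sum_add_distrib, Finset.sum_sub_distrib, hp, N.sum_transpose_D_mulVec,
      Finset.sum_neg_distrib, ← Finset.sum_mul] at hsum
    have hpos : 0 < ∑ i, N.damping i :=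
      Finset.sum_pos (fun i _ => N.damping_pos i) ⟨i₀, Finset.mem_univ _⟩
    have hη : η i₀ = 0 := by
      have : (∑ i, N.damping i) * η i₀ = 0 := by linarith
      exact (mul_eq_zero.1 this).resolve_left hpos.ne'
    refine ⟨?_, ?_⟩
    · ext i
      have := hswing i
      rw [hη] at this
      linarith
    · ext i
      rw [hconst i, hη, Pi.zero_apply]
  · rintro ⟨h1, rfl⟩
    exact ⟨by simp, by simp [swing, h1]⟩

theorem exists_equilibrium_flow {p : V → ℝ} (hp : ∑ i, p i = 0) (f₀ : L → ℝ) :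
    ∃ fInf : L → ℝ, N.Dᵀ *ᵥ fInf = p ∧ N.SameClass fInf f₀ := by
  obtain ⟨θ, hθ⟩ := N.exists_laplacian_eq (b := p - N.Dᵀ *ᵥ f₀) (by
    simp only [Pi.sub_apply, Finset.sum_sub_distrib, hp, N.sum_transpose_D_mulVec, sub_zero])
  exact ⟨f₀ + N.Y *ᵥ (N.D *ᵥ θ), by rw [mulVec_add, hθ]; abel, θ, by abel⟩

end PowerNetwork

/-! ### Convergence of dissipatively controlled networks -/

/-- A trajectory of the network dynamics on `[t₁,∞)` with the constant injection `p` and the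
control `δ + a`, where `a` is the state of a passive filter driven by `-ω` and the feedback `δ`
opposes the frequency, vanishes at small frequencies, and is controlled by the net force.
The differential equations hold outside the countable set `S`. -/
structure DissipativeTrajectory {V L : Type*} [Fintype V] [DecidableEq V] [Fintype L]
    [DecidableEq L] (N : PowerNetwork V L) (p : V → ℝ) (t₁ : ℝ) (S : Set ℝ)
    (f : ℝ → L → ℝ) (ω a δ : ℝ → V → ℝ) : Prop where
  countable : S.Countable
  continuousOn_f : ContinuousOn f (Ici t₁)
  continuousOn_ω : ContinuousOn ω (Ici t₁)
  continuousOn_a : ContinuousOn a (Ici t₁)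
  dynamics : ∀ t, t₁ < t → t ∉ S → N.DynamicsAt f ω p (δ t + a t) t
  filter : ∀ i, ∃ κ > 0, ∃ K ≥ 0, ∀ t, t₁ < t → t ∉ S → ∃ y, HasDerivAt (fun s => a s i) y t ∧
    a t i * y ≤ -(κ * a t i ^ 2) - ω t i * a t i ∧ |y| ≤ K * (|a t i| + |ω t i|)
  feedback_sign : ∀ i t, t₁ < t → ω t i * δ t i ≤ 0
  feedback_bound : ∀ i, ∃ K, ∀ t, t₁ < t → |δ t i| ≤ K + |topLayerV N (f t) (ω t) p (a t) i|
  feedback_small : ∀ i, ∃ r > 0, ∀ t, t₁ < t → |ω t i| < r → δ t i = 0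

/-- The storage function: kinetic energy, flow energy relative to the equilibrium flow `g`, and
filter energy. -/
noncomputable def PowerNetwork.energy {V L : Type*} [Fintype V] [Fintype L] (N : PowerNetwork V L)
    (g : L → ℝ) (f : L → ℝ) (ω a : V → ℝ) : ℝ :=
  (∑ i, N.inertia i * ω i ^ 2 + ∑ k, (f k - g k) ^ 2 / N.susceptance k + ∑ i, a i ^ 2) / 2

section

variable {V L : Type*} [Fintype V] [DecidableEq V] [Fintype L] [DecidableEq L]
  {N : PowerNetwork V L}

theorem PowerNetwork.energy_nonneg (g f : L → ℝ) (ω a : V → ℝ) : 0 ≤ N.energy g f ω a := by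
  have h1 : 0 ≤ ∑ i, N.inertia i * ω i ^ 2 :=
    Finset.sum_nonneg fun i _ => mul_nonneg (N.inertia_pos i).le (sq_nonneg _)
  have h2 : 0 ≤ ∑ k, (f k - g k) ^ 2 / N.susceptance k :=
    Finset.sum_nonneg fun k _ => div_nonneg (sq_nonneg _) (N.susceptance_pos k).le
  have h3 : 0 ≤ ∑ i, a i ^ 2 := Finset.sum_nonneg fun i _ => sq_nonneg _
  unfold energy
  linarith

/-- The sublevel sets of the energy are bounded. -/
theorem PowerNetwork.exists_bound_of_energy_le (g : L → ℝ) (B : ℝ) :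
    ∃ R, ∀ f : L → ℝ, ∀ ω a : V → ℝ, N.energy g f ω a ≤ B →
      ‖f - g‖ ≤ R ∧ ‖ω‖ ≤ R ∧ ‖a‖ ≤ R := by
  -- `x² ≤ C` gives `|x| ≤ C + 1`, which avoids square roots.
  have hsq : ∀ x C : ℝ, x ^ 2 ≤ C → |x| ≤ C + 1 := by
    intro x C h
    rw [← sq_abs] at h
    nlinarith [sq_nonneg (|x| - 1)]
  set R : ℝ := ∑ k, (2 * |B| * N.susceptance k) + ∑ i, 2 * |B| / N.inertia i + 2 * |B| + 1 with hR
  have hL : 0 ≤ ∑ k, (2 * |B| * N.susceptance k) := Finset.sum_nonneg fun k _ =>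
    mul_nonneg (by positivity) (N.susceptance_pos k).le
  have hV : 0 ≤ ∑ i, 2 * |B| / N.inertia i := Finset.sum_nonneg fun i _ =>
    div_nonneg (by positivity) (N.inertia_pos i).le
  have hB0 := abs_nonneg B
  refine ⟨R, fun f ω a h => ?_⟩
  have n1 : ∀ i ∈ Finset.univ, 0 ≤ N.inertia i * ω i ^ 2 :=
    fun i _ => mul_nonneg (N.inertia_pos i).le (sq_nonneg _)
  have n2 : ∀ k ∈ Finset.univ, 0 ≤ (f k - g k) ^ 2 / N.susceptance k :=
    fun k _ => div_nonneg (sq_nonneg _) (N.susceptance_pos k).le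
  have n3 : ∀ i ∈ Finset.univ, 0 ≤ a i ^ 2 := fun i _ => sq_nonneg _
  have s1 := Finset.sum_nonneg n1
  have s2 := Finset.sum_nonneg n2
  have s3 := Finset.sum_nonneg n3
  have hB := h.trans (le_abs_self B)
  unfold energy at hB
  have hR0 : 0 ≤ R := by linarith
  refine ⟨(pi_norm_le_iff_of_nonneg hR0).2 fun k => ?_,
    (pi_norm_le_iff_of_nonneg hR0).2 fun i => ?_, (pi_norm_le_iff_of_nonneg hR0).2 fun i => ?_⟩
  · have h1 := Finset.single_le_sum n2 (Finset.mem_univ k)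
    have hb := N.susceptance_pos k
    have h2 : (f k - g k) ^ 2 ≤ 2 * |B| * N.susceptance k := by
      rw [← div_le_iff₀ hb]
      linarith
    have h3 := Finset.single_le_sum (f := fun k => 2 * |B| * N.susceptance k)
      (fun k _ => mul_nonneg (by positivity) (N.susceptance_pos k).le) (Finset.mem_univ k)
    have := hsq _ _ h2
    simp only [Pi.sub_apply, Real.norm_eq_abs] at *
    linarith
  · have h1 := Finset.single_le_sum n1 (Finset.mem_univ i)
    have hb := N.inertia_pos i
    have h2 : ω i ^ 2 ≤ 2 * |B| / N.inertia i := by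
      rw [le_div_iff₀ hb]
      linarith
    have h3 := Finset.single_le_sum (f := fun i => 2 * |B| / N.inertia i)
      (fun i _ => div_nonneg (by positivity) (N.inertia_pos i).le) (Finset.mem_univ i)
    have := hsq _ _ h2
    simp only [Real.norm_eq_abs] at *
    linarith
  · have h1 := Finset.single_le_sum n3 (Finset.mem_univ i)
    have := hsq (a i) (2 * |B|) (by linarith)
    rw [Real.norm_eq_abs]
    linarith

/-- The flow stays in its class: every linear functional that vanishes on the range of `Y_b D` is
constant along the trajectory. -/
theorem PowerNetwork.sub_mem_flowSpace {f : ℝ → L → ℝ} {ω : ℝ → V → ℝ} {t₀ t : ℝ}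
    (ht : t₀ ≤ t) (hf : ContinuousOn f (Icc t₀ t)) {S : Set ℝ} (hS : S.Countable)
    (h : ∀ s ∈ Ioo t₀ t, s ∉ S → HasDerivAt f (N.Y *ᵥ (N.D *ᵥ ω s)) s) :
    f t - f t₀ ∈ N.flowSpace := by
  by_contra hmem
  obtain ⟨φ, hφ, hker⟩ := Submodule.exists_le_ker_of_notMem hmem
  let Φ := LinearMap.toContinuousLinearMap φ
  have := abs_sub_le_mul_of_hasDerivAt_off_countable (F := fun s => Φ (f s)) (C := 0) ht
    (Φ.continuous.comp_continuousOn hf) hS fun s hs hsS => by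
      have hz : Φ (N.Y *ᵥ (N.D *ᵥ ω s)) = 0 := hker (N.mem_flowSpace.2 ⟨_, rfl⟩)
      exact ⟨_, by rw [hz, abs_zero], Φ.hasFDerivAt.comp_hasDerivAt s (h s hs hsS)⟩
  rw [zero_mul, ← map_sub] at this
  exact hφ (abs_nonpos_iff.1 this)

namespace DissipativeTrajectory

variable {p : V → ℝ} {t₁ : ℝ} {S : Set ℝ} {f : ℝ → L → ℝ} {ω a δ : ℝ → V → ℝ}

theorem hasDerivAt_f (h : DissipativeTrajectory N p t₁ S f ω a δ) {t : ℝ} (ht : t₁ < t)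
    (htS : t ∉ S) (k : L) :
    HasDerivAt (fun s => f s k) (N.susceptance k * (N.D *ᵥ ω t) k) t := by
  have := hasDerivAt_pi.1 (h.dynamics t ht htS).1 k
  simpa [PowerNetwork.Y, mulVec_diagonal] using this

theorem hasDerivAt_ω (h : DissipativeTrajectory N p t₁ S f ω a δ) {t : ℝ} (ht : t₁ < t)
    (htS : t ∉ S) (i : V) :
    ∃ y, HasDerivAt (fun s => ω s i) y t ∧
      N.inertia i * y = -topLayerV N (f t) (ω t) p (a t) i + δ t i := by
  obtain ⟨-, ω', hω', heq⟩ := h.dynamics t ht htS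
  refine ⟨ω' i, hasDerivAt_pi.1 hω' i, ?_⟩
  have := congrFun heq i
  simp only [PowerNetwork.M, PowerNetwork.swing, PowerNetwork.E, mulVec_diagonal, Pi.add_apply,
    Pi.sub_apply, Pi.neg_apply] at this
  rw [this, topLayerV]
  ring

/-- The interconnection of the swing equation, the lines, and the filter is power preserving, so
only damping, filter losses, and the feedback contribute to the energy balance. -/
theorem hasDerivAt_energy (h : DissipativeTrajectory N p t₁ S f ω a δ) {g : L → ℝ}
    (hg : N.Dᵀ *ᵥ g = p) :
    ∃ κ : V → ℝ, (∀ i, 0 < κ i) ∧ ∀ t, t₁ < t → t ∉ S →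
      ∃ y, HasDerivAt (fun s => N.energy g (f s) (ω s) (a s)) y t ∧
        y ≤ -(∑ i, (N.damping i * ω t i ^ 2 + κ i * a t i ^ 2)) := by
  choose κ hκ K _ hK using h.filter
  refine ⟨κ, hκ, fun t ht htS => ?_⟩
  choose ω' hω' hω'eq using h.hasDerivAt_ω ht htS
  choose a' ha' ha'le _ using fun i => hK i t ht htS
  have h1 : HasDerivAt (fun s => ∑ i, N.inertia i * ω s i ^ 2)
      (∑ i, N.inertia i * (2 * ω t i * ω' i)) t := by
    refine HasDerivAt.fun_sum fun i _ => ?_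
    simpa using ((hω' i).fun_pow 2).const_mul (N.inertia i)
  have h2 : HasDerivAt (fun s => ∑ k, (f s k - g k) ^ 2 / N.susceptance k)
      (∑ k, 2 * (f t k - g k) * (N.D *ᵥ ω t) k) t := by
    refine HasDerivAt.fun_sum fun k _ => ?_
    have := (((h.hasDerivAt_f ht htS k).sub_const (g k)).fun_pow 2).div_const (N.susceptance k)
    refine this.congr_deriv ?_
    have := (N.susceptance_pos k).ne'
    norm_num
    field_simp
  have h3 : HasDerivAt (fun s => ∑ i, a s i ^ 2) (∑ i, 2 * a t i * a' i) t := by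
    refine HasDerivAt.fun_sum fun i _ => ?_
    simpa using (ha' i).fun_pow 2
  refine ⟨_, ((h1.fun_add h2).fun_add h3).div_const 2, ?_⟩
  have hflow : ∑ k, 2 * (f t k - g k) * (N.D *ᵥ ω t) k
      = ∑ i, 2 * ((N.Dᵀ *ᵥ f t) i - p i) * ω t i := by
    have : (f t - g) ⬝ᵥ (N.D *ᵥ ω t) = (N.Dᵀ *ᵥ f t - p) ⬝ᵥ ω t := by
      rw [dotProduct_mulVec, ← mulVec_transpose, mulVec_sub, hg]
    simp only [dotProduct, Pi.sub_apply] at this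
    simp only [mul_assoc, ← Finset.mul_sum, this]
  rw [hflow, ← Finset.sum_add_distrib, ← Finset.sum_add_distrib, Finset.sum_div,
    ← Finset.sum_neg_distrib]
  refine Finset.sum_le_sum fun i _ => ?_
  have e1 : N.inertia i * (2 * ω t i * ω' i)
      = 2 * ω t i * (-topLayerV N (f t) (ω t) p (a t) i + δ t i) := by
    rw [← hω'eq i]; ring
  have e2 := h.feedback_sign i t ht
  have e3 := ha'le i
  rw [e1, topLayerV]
  nlinarith

theorem continuousOn_f_apply (h : DissipativeTrajectory N p t₁ S f ω a δ) (k : L) :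
    ContinuousOn (fun t => f t k) (Ici t₁) := continuousOn_pi.1 h.continuousOn_f k

theorem continuousOn_ω_apply (h : DissipativeTrajectory N p t₁ S f ω a δ) (i : V) :
    ContinuousOn (fun t => ω t i) (Ici t₁) := continuousOn_pi.1 h.continuousOn_ω i

theorem continuousOn_a_apply (h : DissipativeTrajectory N p t₁ S f ω a δ) (i : V) :
    ContinuousOn (fun t => a t i) (Ici t₁) := continuousOn_pi.1 h.continuousOn_a i

theorem continuousOn_energy (h : DissipativeTrajectory N p t₁ S f ω a δ) (g : L → ℝ) :
    ContinuousOn (fun s => N.energy g (f s) (ω s) (a s)) (Ici t₁) := by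
  have hf := h.continuousOn_f_apply
  have hω := h.continuousOn_ω_apply
  have ha := h.continuousOn_a_apply
  unfold PowerNetwork.energy
  refine ContinuousOn.div_const (ContinuousOn.add (ContinuousOn.add ?_ ?_) ?_) 2
  · exact continuousOn_finsetSum _ fun i _ => continuousOn_const.mul ((hω i).pow 2)
  · exact continuousOn_finsetSum _ fun k _ => (((hf k).sub continuousOn_const).pow 2).div_const _
  · exact continuousOn_finsetSum _ fun i _ => (ha i).pow 2

theorem exists_state_bound (h : DissipativeTrajectory N p t₁ S f ω a δ) {g : L → ℝ}
    (hg : N.Dᵀ *ᵥ g = p) :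
    ∃ R, ∀ t, t₁ ≤ t → ‖f t - g‖ ≤ R ∧ ‖ω t‖ ≤ R ∧ ‖a t‖ ≤ R := by
  obtain ⟨R, hR⟩ := N.exists_bound_of_energy_le g (N.energy g (f t₁) (ω t₁) (a t₁))
  refine ⟨R, fun t ht => hR _ _ _ ?_⟩
  obtain ⟨κ, hκ, hE⟩ := h.hasDerivAt_energy hg
  have := sub_le_mul_of_hasDerivAt_le_off_countable (C := 0) ht
    ((h.continuousOn_energy g).mono Icc_subset_Ici_self) h.countable fun s hs hsS => by
      obtain ⟨y, hd, hy⟩ := hE s hs.1 hsS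
      refine ⟨y, hy.trans (neg_nonpos.2 (Finset.sum_nonneg fun i _ => ?_)), hd⟩
      have := N.damping_pos i
      have := hκ i
      positivity
  linarith

theorem exists_topLayerV_bound (h : DissipativeTrajectory N p t₁ S f ω a δ) {g : L → ℝ}
    (hg : N.Dᵀ *ᵥ g = p) (i : V) :
    ∃ K, ∀ t, t₁ ≤ t → |topLayerV N (f t) (ω t) p (a t) i| ≤ K := by
  obtain ⟨R, hR⟩ := h.exists_state_bound hg
  let A := LinearMap.toContinuousLinearMap N.Dᵀ.mulVecLin
  refine ⟨N.damping i * R + ‖A‖ * R + R, fun t ht => ?_⟩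
  obtain ⟨h1, h2, h3⟩ := hR t ht
  have e1 : |(N.Dᵀ *ᵥ (f t - g)) i| ≤ ‖A‖ * R :=
    calc |(N.Dᵀ *ᵥ (f t - g)) i| = ‖(A (f t - g)) i‖ := rfl
      _ ≤ ‖A (f t - g)‖ := norm_le_pi_norm _ i
      _ ≤ ‖A‖ * ‖f t - g‖ := A.le_opNorm _
      _ ≤ ‖A‖ * R := mul_le_mul_of_nonneg_left h1 (norm_nonneg _)
  have e2 : |ω t i| ≤ R := (norm_le_pi_norm (ω t) i).trans h2
  have e3 : |a t i| ≤ R := (norm_le_pi_norm (a t) i).trans h3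
  have e4 : |N.damping i * ω t i| ≤ N.damping i * R := by
    rw [abs_mul, abs_of_pos (N.damping_pos i)]
    exact mul_le_mul_of_nonneg_left e2 (N.damping_pos i).le
  have e5 : topLayerV N (f t) (ω t) p (a t) i
      = N.damping i * ω t i + (N.Dᵀ *ᵥ (f t - g)) i - a t i := by
    rw [topLayerV, mulVec_sub, hg, Pi.sub_apply]
    ring
  rw [e5]
  refine (abs_sub _ _).trans (add_le_add ((abs_add_le _ _).trans (add_le_add e4 e1)) e3)

theorem tendsto_ω_apply (h : DissipativeTrajectory N p t₁ S f ω a δ) {g : L → ℝ}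
    (hg : N.Dᵀ *ᵥ g = p) (i : V) : Tendsto (fun t => ω t i) atTop (𝓝 0) := by
  obtain ⟨κ, hκ, hE⟩ := h.hasDerivAt_energy hg
  obtain ⟨K₁, hK₁⟩ := h.exists_topLayerV_bound hg i
  obtain ⟨K₂, hK₂⟩ := h.feedback_bound i
  have hM := N.inertia_pos i
  refine tendsto_zero_of_dissipation (W := fun s => N.energy g (f s) (ω s) (a s))
    (K := (K₁ + (K₂ + K₁)) / N.inertia i) h.countable
    (N.damping_pos i) (h.continuousOn_energy g) (fun _ => N.energy_nonneg _ _ _ _)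
    (h.continuousOn_ω_apply i) (fun t ht htS => ?_) (fun t ht htS => ?_)
  · obtain ⟨y, hd, hy⟩ := hE t ht htS
    refine ⟨y, hy.trans (neg_le_neg ?_), hd⟩
    have hnn : ∀ j ∈ Finset.univ, 0 ≤ N.damping j * ω t j ^ 2 + κ j * a t j ^ 2 := fun j _ => by
      have := N.damping_pos j
      have := hκ j
      positivity
    have := Finset.single_le_sum hnn (Finset.mem_univ i)
    have := mul_nonneg (hκ i).le (sq_nonneg (a t i))
    linarith
  · obtain ⟨y, hd, hy⟩ := h.hasDerivAt_ω ht htS i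
    refine ⟨y, ?_, hd⟩
    have hy' : |N.inertia i * y| ≤ K₁ + (K₂ + K₁) := by
      rw [hy]
      refine (abs_add_le _ _).trans (add_le_add ?_ ((hK₂ t ht).trans ?_))
      · rw [abs_neg]; exact hK₁ t ht.le
      · linarith [hK₁ t ht.le]
    rw [abs_mul, abs_of_pos hM] at hy'
    rw [le_div_iff₀ hM]
    linarith

theorem tendsto_a_apply (h : DissipativeTrajectory N p t₁ S f ω a δ) {g : L → ℝ}
    (hg : N.Dᵀ *ᵥ g = p) (i : V) : Tendsto (fun t => a t i) atTop (𝓝 0) := by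
  obtain ⟨κ, hκ, hE⟩ := h.hasDerivAt_energy hg
  obtain ⟨R, hR⟩ := h.exists_state_bound hg
  obtain ⟨_, _, K, hK0, hK⟩ := h.filter i
  refine tendsto_zero_of_dissipation (W := fun s => N.energy g (f s) (ω s) (a s))
    (K := K * (R + R)) h.countable
    (hκ i) (h.continuousOn_energy g) (fun _ => N.energy_nonneg _ _ _ _)
    (h.continuousOn_a_apply i) (fun t ht htS => ?_) (fun t ht htS => ?_)
  · obtain ⟨y, hd, hy⟩ := hE t ht htS
    refine ⟨y, hy.trans (neg_le_neg ?_), hd⟩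
    have hnn : ∀ j ∈ Finset.univ, 0 ≤ N.damping j * ω t j ^ 2 + κ j * a t j ^ 2 := fun j _ => by
      have := N.damping_pos j
      have := hκ j
      positivity
    have := Finset.single_le_sum hnn (Finset.mem_univ i)
    have := mul_nonneg (N.damping_pos i).le (sq_nonneg (ω t i))
    linarith
  · obtain ⟨y, hd, -, hy⟩ := hK t ht htS
    obtain ⟨-, h2, h3⟩ := hR t ht.le
    refine ⟨y, hy.trans (mul_le_mul_of_nonneg_left (add_le_add ?_ ?_) hK0), hd⟩
    · exact (norm_le_pi_norm (a t) i).trans h3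
    · exact (norm_le_pi_norm (ω t) i).trans h2

theorem eventually_feedback_eq_zero (h : DissipativeTrajectory N p t₁ S f ω a δ) {g : L → ℝ}
    (hg : N.Dᵀ *ᵥ g = p) : ∀ᶠ t in atTop, δ t = 0 := by
  have : ∀ i, ∀ᶠ t in atTop, δ t i = 0 := by
    intro i
    obtain ⟨r, hr, hδ⟩ := h.feedback_small i
    have hlim := (h.tendsto_ω_apply hg i).abs
    rw [abs_zero] at hlim
    filter_upwards [hlim.eventually_lt_const hr, eventually_gt_atTop t₁] with t h1 h2
    exact hδ t h2 h1
  filter_upwards [eventually_all.2 this] with t ht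
  exact funext ht

/-- The net line force on a bus tends to the injection: by the swing equation, over a unit time
interval `M ω` changes by the force imbalance up to an error that tends to zero, while `ω` itself
tends to zero. -/
theorem tendsto_line_force (h : DissipativeTrajectory N p t₁ S f ω a δ) {g : L → ℝ}
    (hg : N.Dᵀ *ᵥ g = p) (i : V) :
    Tendsto (fun t => (N.Dᵀ *ᵥ (f t - g)) i) atTop (𝓝 0) := by
  have hω := tendsto_pi_nhds.2 (h.tendsto_ω_apply hg)
  have hωi := h.tendsto_ω_apply hg i
  have hai := h.tendsto_a_apply hg i
  have hδ := h.eventually_feedback_eq_zero hg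
  set F : ℝ → ℝ := fun t => (N.Dᵀ *ᵥ (f t - g)) i with hF
  set G : ℝ → ℝ := fun t => (N.Dᵀ *ᵥ (N.Y *ᵥ (N.D *ᵥ ω t))) i with hG
  have hFd : ∀ t, t₁ < t → t ∉ S → HasDerivAt F (G t) t := by
    intro t ht htS
    simp only [hF, hG, mulVec, dotProduct]
    refine HasDerivAt.fun_sum fun k _ => HasDerivAt.const_mul _ ?_
    have := ((hasDerivAt_pi.1 (h.dynamics t ht htS).1 k).sub_const (g k))
    exact this
  have hFc : ContinuousOn F (Ici t₁) := by
    simp only [hF, mulVec, dotProduct]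
    exact continuousOn_finsetSum _ fun k _ =>
      continuousOn_const.mul ((h.continuousOn_f_apply k).sub continuousOn_const)
  have hGlim : Tendsto G atTop (𝓝 0) := by
    have hc : Continuous fun w : V → ℝ => (N.Dᵀ *ᵥ (N.Y *ᵥ (N.D *ᵥ w))) i := by fun_prop
    have h0 := hc.tendsto 0
    simp only [mulVec_zero, Pi.zero_apply] at h0
    exact h0.comp hω
  rw [Metric.tendsto_atTop']
  intro η hη
  have hM := N.inertia_pos i
  have hE := N.damping_pos i
  -- Five errors of size `η / 6` are allowed: `M ω` at both ends of the interval, and `E ω`, `a` and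
  -- the oscillation of the line force inside it. Beyond `t₂` each is small and `δ` vanishes.
  have small : ∀ {x : ℝ → ℝ}, Tendsto x atTop (𝓝 0) →
      ∀ c > 0, ∀ᶠ t in atTop, c * |x t| ≤ η / 6 := by
    intro x hx c hc
    have : Tendsto (fun t => c * |x t|) atTop (𝓝 (c * |0|)) := hx.abs.const_mul c
    rw [abs_zero, mul_zero] at this
    exact this.eventually_le_const (by positivity)
  obtain ⟨t₂, ht₂⟩ := eventually_atTop.1 ((small hωi _ hM).and ((small hωi _ hE).and
    ((small hai 1 one_pos).and ((small hGlim 1 one_pos).and hδ))))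
  refine ⟨max t₁ t₂, fun t ht => ?_⟩
  have ht1 : t₁ < t := (le_max_left _ _).trans_lt ht
  have ht2 : t₂ < t := (le_max_right _ _).trans_lt ht
  have hsub : Icc t (t + 1) ⊆ Ici t₁ := fun s hs => ht1.le.trans hs.1
  have hFosc : ∀ s ∈ Icc t (t + 1), |F s - F t| ≤ η / 6 := by
    intro s hs
    have := abs_sub_le_mul_of_hasDerivAt_off_countable (C := η / 6) hs.1
      (hFc.mono fun u hu => ht1.le.trans hu.1) h.countable fun u hu huS => by
        have := (ht₂ u (ht2.trans hu.1).le).2.2.2.1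
        rw [one_mul] at this
        exact ⟨G u, this, hFd u (ht1.trans hu.1) huS⟩
    refine this.trans ?_
    have := hs.2
    nlinarith
  have hmain := abs_sub_le_mul_of_hasDerivAt_off_countable
    (F := fun s => N.inertia i * ω s i + F t * s) (C := η / 2) (show t ≤ t + 1 by linarith)
    ((continuousOn_const.mul (h.continuousOn_ω_apply i)).add (by fun_prop) |>.mono hsub)
    h.countable fun s hs hsS => by
      obtain ⟨y, hd, hy⟩ := h.hasDerivAt_ω (ht1.trans hs.1) hsS i
      obtain ⟨-, b2, b3, -, b5⟩ := ht₂ s (ht2.trans hs.1).le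
      have b4 := hFosc s ⟨hs.1.le, hs.2.le⟩
      refine ⟨N.inertia i * y + F t * 1, ?_,
        (hd.const_mul _).add ((hasDerivAt_id s).const_mul (F t))⟩
      have hv : topLayerV N (f s) (ω s) p (a s) i = N.damping i * ω s i + F s - a s i := by
        rw [topLayerV, hF]
        simp only [mulVec_sub, hg, Pi.sub_apply]
        ring
      have e : N.inertia i * y + F t * 1 = -(N.damping i * ω s i) + a s i - (F s - F t) := by
        rw [hy, hv, b5, Pi.zero_apply]
        ring
      rw [e]
      have c2 : |-(N.damping i * ω s i)| ≤ η / 6 := by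
        rw [abs_neg, abs_mul, abs_of_pos hE]; exact b2
      rw [one_mul] at b3
      have := abs_sub (-(N.damping i * ω s i) + a s i) (F s - F t)
      have := abs_add_le (-(N.damping i * ω s i)) (a s i)
      linarith
  obtain ⟨b1, -⟩ := ht₂ t ht2.le
  obtain ⟨b1', -⟩ := ht₂ (t + 1) (by linarith)
  rw [Real.dist_eq, sub_zero]
  have c1 : |N.inertia i * ω t i| ≤ η / 6 := by rw [abs_mul, abs_of_pos hM]; exact b1
  have c2 : |N.inertia i * ω (t + 1) i| ≤ η / 6 := by rw [abs_mul, abs_of_pos hM]; exact b1'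
  rw [abs_le] at c1 c2 hmain
  rw [abs_lt]
  constructor <;> linarith [hmain.1, hmain.2, c1.1, c1.2, c2.1, c2.2]

theorem tendsto_f (h : DissipativeTrajectory N p t₁ S f ω a δ) {g : L → ℝ}
    (hg : N.Dᵀ *ᵥ g = p) (hclass : N.SameClass (f t₁) g) : Tendsto f atTop (𝓝 g) := by
  obtain ⟨K, hK⟩ := N.exists_norm_le_of_mem_flowSpace
  have hforce : Tendsto (fun t => N.Dᵀ *ᵥ (f t - g)) atTop (𝓝 0) :=
    tendsto_pi_nhds.2 (h.tendsto_line_force hg)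
  have hlim : Tendsto (fun t => K * ‖N.Dᵀ *ᵥ (f t - g)‖) atTop (𝓝 0) := by
    simpa using hforce.norm.const_mul K
  rw [tendsto_iff_norm_sub_tendsto_zero]
  refine squeeze_zero' (Eventually.of_forall fun _ => norm_nonneg _) ?_ hlim
  filter_upwards [eventually_ge_atTop t₁] with t ht
  refine hK _ ?_
  have := N.flowSpace.add_mem (N.sub_mem_flowSpace ht
    (h.continuousOn_f.mono Icc_subset_Ici_self) h.countable
    fun s hs hsS => (h.dynamics s hs.1 hsS).1) (N.sameClass_iff.1 hclass)
  simpa using this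

end DissipativeTrajectory

end

/-! ### The controller -/

section

variable {V L : Type*} [Fintype V] [DecidableEq V] [Fintype L] [DecidableEq L]
  {N : PowerNetwork V L} {C : ControllerData V}

theorem abs_sat_le {a b : ℝ} (hb : 0 ≤ b) : |sat a b (-b)| ≤ b := by
  unfold sat
  split_ifs with h1 h2
  · rw [abs_of_nonneg hb]
  · rw [abs_neg, abs_of_nonneg hb]
  · exact abs_le.2 ⟨(not_le.1 h2).le, (not_le.1 h1).le⟩

theorem abs_stabilityFilter_le {i : V} (hi : i ∈ C.Iu) (a u : V → ℝ) :
    |stabilityFilter C a u i| ≤ C.ε i * |a i| :=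
  abs_sat_le (mul_nonneg (C.ε_pos i hi).le (abs_nonneg _))

theorem mul_alphaDF_nonpos (f : L → ℝ) (ω p a : V → ℝ) (i : V) :
    ω i * alphaDF N C f ω p a i ≤ 0 := by
  unfold alphaDF
  split_ifs with h1 h2 h3
  · exact mul_nonpos_of_nonneg_of_nonpos ((C.hiThr_pos i h1).trans h2).le (min_le_left _ _)
  · exact mul_nonpos_of_nonpos_of_nonneg (h3.trans (C.loThr_neg i h1)).le (le_max_left _ _)
  all_goals simp

theorem alphaDF_eq_zero_of_abs_lt (i : V) :
    ∃ r > 0, ∀ (f : L → ℝ) (ω p a : V → ℝ), |ω i| < r → alphaDF N C f ω p a i = 0 := by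
  by_cases hi : i ∈ C.Iω
  · refine ⟨min (C.hiThr i) (-C.loThr i),
      lt_min (C.hiThr_pos i hi) (neg_pos.2 (C.loThr_neg i hi)), fun f ω p a h => ?_⟩
    obtain ⟨h1, h2⟩ := lt_min_iff.1 h
    have h1' := (abs_lt.1 h1).2
    have h2' := (abs_lt.1 h2).1
    rw [neg_neg] at h2'
    rw [alphaDF, if_pos hi, if_neg h1'.not_gt, if_neg h2'.not_gt]
  · exact ⟨1, one_pos, fun f ω p a _ => by rw [alphaDF, if_neg hi]⟩

/-- The barrier quotients of the top layer blow up only with the sign that the truncation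
discards: above the upper threshold `γ (hi - ω) / (ω - hiThr) ≥ -γ`, and similarly below the
lower one. -/
theorem exists_abs_alphaDF_le (i : V) :
    ∃ K, ∀ (f : L → ℝ) (ω p a : V → ℝ),
      |alphaDF N C f ω p a i| ≤ K + |topLayerV N f ω p a i| := by
  refine ⟨|C.γhi i| + |C.γlo i|, fun f ω p a => ?_⟩
  have n1 := abs_nonneg (C.γhi i)
  have n2 := abs_nonneg (C.γlo i)
  have n3 := abs_nonneg (topLayerV N f ω p a i)
  have n4 := neg_abs_le (topLayerV N f ω p a i)
  have n5 := le_abs_self (topLayerV N f ω p a i)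
  unfold alphaDF
  split_ifs with h1 h2 h3
  · have hq : -|C.γhi i| ≤ C.γhi i * (C.hi i - ω i) / (ω i - C.hiThr i) := by
      rw [le_div_iff₀ (sub_pos.2 h2), abs_of_pos (C.γhi_pos i h1)]
      nlinarith [C.γhi_pos i h1, C.lt_hi i h1]
    rw [abs_of_nonpos (min_le_left _ _), neg_le]
    exact le_min (by linarith) (by linarith)
  · have hq : C.γlo i * (C.lo i - ω i) / (C.loThr i - ω i) ≤ |C.γlo i| := by
      rw [div_le_iff₀ (sub_pos.2 h3), abs_of_pos (C.γlo_pos i h1)]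
      nlinarith [C.γlo_pos i h1, C.lo_lt i h1]
    rw [abs_of_nonneg (le_max_left _ _)]
    exact max_le (by linarith) (by linarith)
  all_goals rw [abs_zero]; positivity

/-- Above the upper bound the top layer cancels the net force and adds a negative one. -/
theorem alphaDF_le_topLayerV {i : V} (hi : i ∈ C.Iω) {f : L → ℝ} {ω p a : V → ℝ}
    (h : C.hi i < ω i) : alphaDF N C f ω p a i ≤ topLayerV N f ω p a i := by
  have hthr : C.hiThr i < ω i := (C.lt_hi i hi).trans h
  rw [alphaDF, if_pos hi, if_pos hthr]
  refine (min_le_right _ _).trans (add_le_of_nonpos_left ?_)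
  exact div_nonpos_of_nonpos_of_nonneg
    (mul_nonpos_of_nonneg_of_nonpos (C.γhi_pos i hi).le (by linarith)) (by linarith)

/-- Below the lower bound the top layer cancels the net force and adds a positive one. -/
theorem topLayerV_le_alphaDF {i : V} (hi : i ∈ C.Iω) {f : L → ℝ} {ω p a : V → ℝ}
    (h : ω i < C.lo i) : topLayerV N f ω p a i ≤ alphaDF N C f ω p a i := by
  have hthr : ω i < C.loThr i := h.trans (C.lo_lt i hi)
  have hhi : ¬ C.hiThr i < ω i := by
    have := C.loThr_neg i hi
    have := C.hiThr_pos i hi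
    linarith
  rw [alphaDF, if_pos hi, if_neg hhi, if_pos hthr]
  refine le_trans (le_add_of_nonneg_left ?_) (le_max_right _ _)
  exact div_nonneg (mul_nonneg (C.γlo_pos i hi).le (by linarith)) (by linarith)

namespace IsClosedLoopTrajectory

variable {p : ℝ → V → ℝ} {pf : ℝ → ℝ → V → ℝ} {f : ℝ → L → ℝ} {ω a u : ℝ → V → ℝ}

theorem exists_hasDerivAt_ω (h : IsClosedLoopTrajectory N C p pf f ω a u) :
    ∃ S : Set ℝ, S.Countable ∧ ∀ t, 0 < t → t ∉ S → ∀ i, ∃ y, HasDerivAt (fun s => ω s i) y t ∧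
      N.inertia i * y = -topLayerV N (f t) (ω t) (p t) (a t) i
        + alphaDF N C (f t) (ω t) (p t) (a t) i := by
  obtain ⟨S, hS, hode⟩ := h.ode
  refine ⟨S, hS, fun t ht htS i => ?_⟩
  obtain ⟨⟨-, ω', hω', heq⟩, -⟩ := hode t ht htS
  refine ⟨ω' i, hasDerivAt_pi.1 hω' i, ?_⟩
  have := congrFun heq i
  simp only [PowerNetwork.M, PowerNetwork.swing, PowerNetwork.E, mulVec_diagonal, Pi.add_apply,
    Pi.sub_apply, Pi.neg_apply, alphaTotal] at this
  rw [this, topLayerV]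
  ring

theorem frequency_invariance (h : IsClosedLoopTrajectory N C p pf f ω a u) {i : V}
    (hi : i ∈ C.Iω) (h0 : ω 0 i ∈ Icc (C.lo i) (C.hi i)) {t : ℝ} (ht : 0 ≤ t) :
    ω t i ∈ Icc (C.lo i) (C.hi i) := by
  obtain ⟨S, hS, hode⟩ := h.exists_hasDerivAt_ω
  have hc : ContinuousOn (fun s => ω s i) (Ici 0) := continuousOn_pi.1 h.continuousOn_ω i
  have hM := N.inertia_pos i
  constructor
  · have := le_of_barrier (x := fun s => -ω s i) (c := -C.lo i) ht hc.neg hS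
      (neg_le_neg h0.1) fun s hs hsS hlt => by
        obtain ⟨y, hd, hy⟩ := hode s hs hsS i
        refine ⟨-y, ?_, hd.neg⟩
        have := topLayerV_le_alphaDF (N := N) (f := f s) (p := p s) (a := a s) hi
          (neg_lt_neg_iff.1 hlt)
        exact neg_nonpos.2 (nonneg_of_mul_nonneg_right (by linarith) hM)
    exact neg_le_neg_iff.1 this
  · refine le_of_barrier ht hc hS h0.2 fun s hs hsS hlt => ?_
    obtain ⟨y, hd, hy⟩ := hode s hs hsS i
    refine ⟨y, ?_, hd⟩
    have := alphaDF_le_topLayerV (N := N) (f := f s) (p := p s) (a := a s) hi hlt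
    by_contra! hpos
    have := mul_pos hM hpos
    linarith

/-- Once the injection is constant, the closed loop is dissipative. The filter is strictly passive
because the saturation limits its input to `ε |a|` with `ε < 1 / τ`. -/
theorem dissipativeTrajectory (h : IsClosedLoopTrajectory N C p pf f ω a u)
    (hεT : ∀ i ∈ C.Iu, C.ε i * C.τ i < 1) {pstar : V → ℝ} {t₁ : ℝ} (ht₁ : 0 ≤ t₁)
    (hp : ∀ t, t₁ ≤ t → p t = pstar) :
    ∃ S, DissipativeTrajectory N pstar t₁ S f ω a
      (fun t => alphaDF N C (f t) (ω t) (p t) (a t)) := by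
  obtain ⟨S, hS, hode⟩ := h.ode
  have hsub : Ici t₁ ⊆ Ici 0 := Ici_subset_Ici.2 ht₁
  refine ⟨S, hS, h.continuousOn_f.mono hsub, h.continuousOn_ω.mono hsub, h.continuousOn_a.mono hsub,
    fun t ht htS => ?_, fun i => ?_, fun i t _ => mul_alphaDF_nonpos _ _ _ _ _, fun i => ?_,
    fun i => ?_⟩
  · have := (hode t (ht₁.trans_lt ht) htS).1
    rw [hp t ht.le] at this ⊢
    exact this
  · by_cases hi : i ∈ C.Iu
    · have hτ := C.τ_pos i hi
      have hε := C.ε_pos i hi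
      have hκ : 0 < 1 / C.τ i - C.ε i := by
        rw [sub_pos, lt_div_iff₀ hτ]
        exact hεT i hi
      refine ⟨_, hκ, 1 / C.τ i + C.ε i + 1, by positivity, fun t ht htS => ?_⟩
      have hu := abs_stabilityFilter_le hi (a t) (u t)
      refine ⟨_, (hode t (ht₁.trans_lt ht) htS).2 i hi, ?_, ?_⟩
      · have h1 : a t i * stabilityFilter C (a t) (u t) i ≤ C.ε i * a t i ^ 2 := by
          calc a t i * stabilityFilter C (a t) (u t) i
              ≤ |a t i| * |stabilityFilter C (a t) (u t) i| := by
                rw [← abs_mul]; exact le_abs_self _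
            _ ≤ |a t i| * (C.ε i * |a t i|) := mul_le_mul_of_nonneg_left hu (abs_nonneg _)
            _ = C.ε i * a t i ^ 2 := by rw [← sq_abs (a t i)]; ring
        linarith
      · have h1 : |-(1 / C.τ i) * a t i| = 1 / C.τ i * |a t i| := by
          rw [neg_mul, abs_neg, abs_mul, abs_of_pos (by positivity)]
        have h2 := abs_add_le (-(1 / C.τ i) * a t i - ω t i) (stabilityFilter C (a t) (u t) i)
        have h3 := abs_sub (-(1 / C.τ i) * a t i) (ω t i)
        have h4 : 0 ≤ (1 / C.τ i + C.ε i) * |ω t i| := by positivity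
        have h5 := abs_nonneg (a t i)
        linarith
    · refine ⟨1, one_pos, 0, le_rfl, fun t ht _ => ⟨0, ?_, ?_, by simp⟩⟩
      · refine (hasDerivAt_const t (0 : ℝ)).congr_of_eventuallyEq ?_
        filter_upwards [lt_mem_nhds (ht₁.trans_lt ht)] with s hs
        exact h.filter_zero s hs.le i hi
      · simp [h.filter_zero t (ht₁.trans ht.le) i hi]
  · obtain ⟨K, hK⟩ := exists_abs_alphaDF_le (N := N) (C := C) i
    refine ⟨K, fun t ht => ?_⟩
    rw [hp t ht.le]
    exact hK _ _ _ _
  · obtain ⟨r, hr, hz⟩ := alphaDF_eq_zero_of_abs_lt (N := N) (C := C) i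
    exact ⟨r, hr, fun t _ => hz _ _ _ _⟩

theorem sameClass (h : IsClosedLoopTrajectory N C p pf f ω a u) {g : L → ℝ}
    (h0 : N.SameClass (f 0) g) {t : ℝ} (ht : 0 ≤ t) : N.SameClass (f t) g := by
  obtain ⟨S, hS, hode⟩ := h.ode
  have := N.flowSpace.add_mem (N.sub_mem_flowSpace ht
    (h.continuousOn_f.mono Icc_subset_Ici_self) hS
    fun s hs hsS => (hode s hs.1 hsS).1.1) (N.sameClass_iff.1 h0)
  rw [N.sameClass_iff]
  simpa using this

end IsClosedLoopTrajectory

namespace PowerNetwork.IsOpenLoopTrajectory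

variable {p : ℝ → V → ℝ} {f : ℝ → L → ℝ} {ω : ℝ → V → ℝ}

theorem dissipativeTrajectory (h : N.IsOpenLoopTrajectory p f ω) {pstar : V → ℝ} {t₁ : ℝ}
    (ht₁ : 0 ≤ t₁) (hp : ∀ t, t₁ ≤ t → p t = pstar) :
    ∃ S, DissipativeTrajectory N pstar t₁ S f ω 0 0 := by
  obtain ⟨S, hS, hode⟩ := h.ode
  have hsub : Ici t₁ ⊆ Ici 0 := Ici_subset_Ici.2 ht₁
  refine ⟨S, hS, h.continuousOn_f.mono hsub, h.continuousOn_ω.mono hsub, continuousOn_const,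
    fun t ht htS => ?_, fun i => ⟨1, one_pos, 0, le_rfl, fun t _ _ => ⟨0, ?_, by simp, by simp⟩⟩,
    fun i t _ => by simp, fun i => ⟨0, fun t _ => by simp⟩, fun i => ⟨1, one_pos, by simp⟩⟩
  · have := hode t (ht₁.trans_lt ht) htS
    rw [hp t ht.le] at this
    simpa using this
  · exact hasDerivAt_const t (0 : ℝ)

theorem sameClass (h : N.IsOpenLoopTrajectory p f ω) {g : L → ℝ}
    (h0 : N.SameClass (f 0) g) {t : ℝ} (ht : 0 ≤ t) : N.SameClass (f t) g := by
  obtain ⟨S, hS, hode⟩ := h.ode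
  have := N.flowSpace.add_mem (N.sub_mem_flowSpace ht
    (h.continuousOn_f.mono Icc_subset_Ici_self) hS
    fun s hs hsS => (hode s hs.1 hsS).1) (N.sameClass_iff.1 h0)
  rw [N.sameClass_iff]
  simpa using this

end PowerNetwork.IsOpenLoopTrajectory

end

/-! ### Invariance, attractivity, and convergence -/

theorem mainTheorem1 {V L : Type*} [Fintype V] [DecidableEq V] [Fintype L] [DecidableEq L]
    (N : PowerNetwork V L) (C : ControllerData V)
    (p : ℝ → V → ℝ) (pstar : V → ℝ) (hp : FiniteTimeConvergent p pstar)
    (pf : ℝ → ℝ → V → ℝ)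
    (hεT : ∀ i ∈ C.Iu, C.ε i * C.τ i < 1) :
    (∀ (f : ℝ → L → ℝ) (ω a u : ℝ → V → ℝ), IsClosedLoopTrajectory N C p pf f ω a u →
      -- frequency invariance
      (∀ i ∈ C.Iω, ω 0 i ∈ Set.Icc (C.lo i) (C.hi i) →
        ∀ t, 0 ≤ t → ω t i ∈ Set.Icc (C.lo i) (C.hi i)) ∧
      -- frequency attractivity
      (∀ i ∈ C.Iω, ω 0 i ∉ Set.Icc (C.lo i) (C.hi i) →
        ∃ t₀ : ℝ, 0 ≤ t₀ ∧ ∀ t, t₀ ≤ t → ω t i ∈ Set.Icc (C.lo i) (C.hi i)) ∧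
      -- the control signals vanish asymptotically
      Filter.Tendsto (fun t => alphaTotal N C (f t) (ω t) (p t) (a t)) Filter.atTop (nhds 0) ∧
      Filter.Tendsto a Filter.atTop (nhds 0) ∧
      Filter.Tendsto (fun t => alphaDF N C (f t) (ω t) (p t) (a t)) Filter.atTop (nhds 0)) ∧
    -- global convergence to the open-loop equilibrium
    (∀ f₀ : L → ℝ, ∃ fInf : L → ℝ,
      (∀ (g : L → ℝ) (η : V → ℝ),
        (N.IsOpenLoopEquilibrium pstar g η ∧ N.SameClass g f₀) ↔ (g = fInf ∧ η = 0)) ∧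
      (∀ (f : ℝ → L → ℝ) (ω : ℝ → V → ℝ),
        N.IsOpenLoopTrajectory p f ω → N.SameClass (f 0) f₀ →
        Filter.Tendsto f Filter.atTop (nhds fInf) ∧ Filter.Tendsto ω Filter.atTop (nhds 0)) ∧
      (∀ (f : ℝ → L → ℝ) (ω a u : ℝ → V → ℝ),
        IsClosedLoopTrajectory N C p pf f ω a u → N.SameClass (f 0) f₀ →
        Filter.Tendsto f Filter.atTop (nhds fInf) ∧ Filter.Tendsto ω Filter.atTop (nhds 0))) := by
  obtain ⟨t₁, ht₁, hconst⟩ := hp.eventually_const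
  have hpt : ∀ t, t₁ ≤ t → p t = pstar := fun t ht => funext fun i => hconst i t ht
  refine ⟨fun f ω a u h => ?_, fun f₀ => ?_⟩
  · obtain ⟨g, hg, -⟩ := N.exists_equilibrium_flow hp.balanced 0
    obtain ⟨S, hdiss⟩ := h.dissipativeTrajectory hεT ht₁ hpt
    have hδ : Tendsto (fun t => alphaDF N C (f t) (ω t) (p t) (a t)) atTop (𝓝 0) :=
      tendsto_const_nhds.congr' ((hdiss.eventually_feedback_eq_zero hg).mono fun t ht => ht.symm)
    have ha : Tendsto a atTop (𝓝 0) := tendsto_pi_nhds.2 (hdiss.tendsto_a_apply hg)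
    refine ⟨fun i hi h0 t ht => h.frequency_invariance hi h0 ht, fun i hi _ => ?_, ?_, ha, hδ⟩
    · have hlo : C.lo i < 0 := (C.lo_lt i hi).trans (C.loThr_neg i hi)
      have hhi : 0 < C.hi i := (C.hiThr_pos i hi).trans (C.lt_hi i hi)
      obtain ⟨t₀, ht₀⟩ := eventually_atTop.1
        ((hdiss.tendsto_ω_apply hg i).eventually_mem (Icc_mem_nhds hlo hhi))
      exact ⟨max t₀ 0, le_max_right _ _, fun t ht => ht₀ t ((le_max_left _ _).trans ht)⟩
    · simpa [alphaTotal] using hδ.add ha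
  · obtain ⟨fInf, hD, hclass⟩ := N.exists_equilibrium_flow hp.balanced f₀
    have hclass' := N.sameClass_iff.1 hclass
    have trans : ∀ {g}, N.SameClass g f₀ → N.SameClass g fInf := by
      intro g hgc
      rw [N.sameClass_iff] at hgc ⊢
      simpa using N.flowSpace.sub_mem hgc hclass'
    refine ⟨fInf, fun g η => ?_, fun f ω h h0 => ?_, fun f ω a u h h0 => ?_⟩
    · rw [N.isOpenLoopEquilibrium_iff hp.balanced]
      constructor
      · rintro ⟨⟨h1, h2⟩, h3⟩
        refine ⟨sub_eq_zero.1 (N.eq_zero_of_mem_flowSpace (N.sameClass_iff.1 (trans h3)) ?_), h2⟩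
        rw [mulVec_sub, h1, hD, sub_self]
      · rintro ⟨rfl, rfl⟩
        exact ⟨⟨hD, rfl⟩, hclass⟩
    · obtain ⟨S, hdiss⟩ := h.dissipativeTrajectory ht₁ hpt
      exact ⟨hdiss.tendsto_f hD (h.sameClass (trans h0) ht₁),
        tendsto_pi_nhds.2 (hdiss.tendsto_ω_apply hD)⟩
    · obtain ⟨S, hdiss⟩ := h.dissipativeTrajectory hεT ht₁ hpt
      exact ⟨hdiss.tendsto_f hD (h.sameClass (trans h0) ht₁),
        tendsto_pi_nhds.2 (hdiss.tendsto_ω_apply hD)⟩
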